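/- Let $(X_n)_{n\ge 1}$ be independent identically distributed real random variables with $\mathbf{E}X_1^2<\infty$. Put $$Z_n=\frac{X_1+\dots+X_n}{\sqrt n}\quad(n\ge 1),\qquad f_1(t)=\mathbf{E}\,e^{itX_1}\quad(t\in\mathbb{R}).$$ If a random variable $X$ has an absolutely continuous density $p$ (that is, $p$ is absolutely continuous on every compact interval), its Fisher information is $I(X)=\int_{\{p>0\}}\frac{p'(x)^2}{p(x)}\,dx\in[0,\infty]$, where $p'$ is the Radon--Nikodym derivative of $p$; in all other cases $I(X)=+\infty$. The following assertions are equivalent: (a) for some $n_0\ge 1$, $Z_{n_0}$ has finite Fisher information, $I(Z_{n_0})<\infty$; (b) for some $n_0\ge 1$, $Z_{n_0}$ has a density of bounded total variation on $\mathbb{R}$; (c) for some $n_0\ge 1$, $Z_{n_0}$ has a continuously differentiable density $p_{n_0}$ such that $\int_{-\infty}^{+\infty}|p_{n_0}'(x)|\,dx<\infty$; (d) for some $\varepsilon>0$, $|f_1(t)|=O(t^{-\varepsilon})$ as $t\to+\infty$; (e) for some $\nu>0$, $\int_{-\infty}^{+\infty}|f_1(t)|^{\nu}\,|t|\,dt<\infty$.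 -/

import Mathlib

open MeasureTheory ProbabilityTheory Filter
open scoped ENNReal Topology

noncomputable section

/-- `p` is a (probability) density of the measure `μ` on the real line, with respect to
Lebesgue measure. -/
structure IsDensity (p : ℝ → ℝ) (μ : Measure ℝ) : Prop where
  measurable : Measurable p
  nonneg : ∀ x, 0 ≤ p x
  eq_withDensity : μ = volume.withDensity (fun x => ENNReal.ofReal (p x))

/-- Absolute continuity of a function on the real line: absolute continuity on every compact
interval. -/
def IsAbsCont (p : ℝ → ℝ) : Prop :=
  ∀ a b : ℝ, AbsolutelyContinuousOnInterval p a b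

/-- The integral of `p'(x)² / p(x)` over `{p > 0}`, as an extended nonnegative number. For an
absolutely continuous `p`, `deriv p` is the Radon-Nikodym derivative of `p`. -/
def fisherIntegral (p : ℝ → ℝ) : ℝ≥0∞ :=
  ∫⁻ x in {x | 0 < p x}, ENNReal.ofReal (deriv p x ^ 2 / p x)

/-- The Fisher information of a measure on the line: `fisherIntegral p` if the measure has an
absolutely continuous density `p` (which is then unique, see `fisherInfo_eq`), and `∞` (the infimum
over the empty family) otherwise. -/
def fisherInfo (μ : Measure ℝ) : ℝ≥0∞ :=
  ⨅ (p : ℝ → ℝ) (_ : IsDensity p μ) (_ : IsAbsCont p), fisherIntegral p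

/-- The normalized sum `Z_n = (X_1 + ... + X_n) / √n`; the sequence `X_1, X_2, ...` is indexed by
`ℕ`, so that `X 0` stands for `X_1`. -/
def normalizedSum {Ω : Type*} (X : ℕ → Ω → ℝ) (n : ℕ) (ω : Ω) : ℝ :=
  (∑ i ∈ Finset.range n, X i ω) / √(n : ℝ)

theorem IsAbsCont.continuous {p : ℝ → ℝ} (hp : IsAbsCont p) : Continuous p := by
  rw [continuous_iff_continuousAt]
  intro x
  have h := (hp (x - 1) (x + 1)).uniformContinuousOn.continuousOn
  refine h.continuousAt ?_
  rw [Set.uIcc_of_le (by linarith)]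
  exact Icc_mem_nhds (by linarith) (by linarith)

theorem fisherInfo_eq {μ : Measure ℝ} [IsFiniteMeasure μ] {p : ℝ → ℝ} (hp : IsDensity p μ)
    (hc : IsAbsCont p) : fisherInfo μ = fisherIntegral p := by
  refine le_antisymm (iInf_le_of_le p (iInf₂_le_of_le hp hc le_rfl)) ?_
  refine le_iInf fun q => le_iInf fun hq => le_iInf fun hqc => ?_
  have h : (fun x => ENNReal.ofReal (p x)) =ᵐ[volume] fun x => ENNReal.ofReal (q x) := by
    refine (withDensity_eq_iff_of_sigmaFinite hp.measurable.ennreal_ofReal.aemeasurable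
      hq.measurable.ennreal_ofReal.aemeasurable).1 ?_
    rw [← hp.eq_withDensity, ← hq.eq_withDensity]
  have h2 : p =ᵐ[volume] q := by
    filter_upwards [h] with x hx
    exact (ENNReal.ofReal_eq_ofReal_iff (hp.nonneg x) (hq.nonneg x)).1 hx
  rw [Continuous.ae_eq_iff_eq volume hc.continuous hqc.continuous] at h2
  rw [h2]

end

/-!
If the Fisher information is finite, then `|p'| ≤ p' ^ 2 / p + p` shows that `p'` is integrable, so
that `p` has bounded variation. Comparing the Fourier integral of a function of bounded variation
`V` with its translate by half a period bounds it by `V / (4 * |w|)`; hence `|f₁| ^ n` is `O(t⁻¹)`.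

Conversely, suppose that `f₁` decays polynomially. Under a second moment the derivatives of `f₁ ^ N`
up to order two are `O(|f₁| ^ (N - 2))`, hence decay as fast as needed for large `N`, and Fourier
inversion gives a smooth density whose derivatives are `O(1 / (1 + x ^ 2))`. A nonnegative function
with `|p'|, |p''| ≤ M` near `x` satisfies Landau's inequality `p' ^ 2 ≤ 2 * M * p` at `x`, so the
integrand of the Fisher information is `O(1 / (1 + x ^ 2))` too.

Integrability of `|f₁| ^ ν * |t|` gives decay because `f₁` is Lipschitz: `|f₁|` exceeds half of
`|f₁ t|` on an interval of length proportional to `|f₁ t|`, so `|f₁ t| ^ (ν + 1) * t` is bounded.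
-/

open scoped NNReal FourierTransform ComplexConjugate

theorem IsAbsCont.eVariationOn_le {p : ℝ → ℝ} (hp : IsAbsCont p) :
    eVariationOn p Set.univ ≤ ∫⁻ x, ‖deriv p x‖ₑ := by
  refine iSup_le fun ⟨n, u, hu, _⟩ => ?_
  have increment_le (i : ℕ) : edist (p (u (i + 1))) (p (u i)) ≤
      ∫⁻ x in Set.Ioc (u i) (u (i + 1)), ‖deriv p x‖ₑ := by
    rw [edist_eq_enorm_sub, ← (hp _ _).integral_deriv_eq_sub,
      intervalIntegral.integral_of_le (hu i.le_succ)]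
    exact enorm_integral_le_lintegral_enorm _
  calc ∑ i ∈ Finset.range n, edist (p (u (i + 1))) (p (u i))
      ≤ ∑ i ∈ Finset.range n, ∫⁻ x in Set.Ioc (u i) (u (i + 1)), ‖deriv p x‖ₑ :=
        Finset.sum_le_sum fun i _ => increment_le i
    _ = ∫⁻ x in ⋃ i ∈ Finset.range n, Set.Ioc (u i) (u (i + 1)), ‖deriv p x‖ₑ :=
        (lintegral_biUnion_finset (hu.pairwise_disjoint_on_Ioc_succ.set_pairwise _)
          (fun _ _ => measurableSet_Ioc) _).symm
    _ ≤ ∫⁻ x, ‖deriv p x‖ₑ := setLIntegral_le_lintegral _ _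

theorem IsAbsCont.boundedVariationOn {p : ℝ → ℝ} (hp : IsAbsCont p)
    (hi : Integrable (deriv p)) : BoundedVariationOn p Set.univ :=
  (hp.eVariationOn_le.trans_lt hi.2).ne

theorem IsAbsCont.of_contDiff {p : ℝ → ℝ} (hp : ContDiff ℝ 1 p) : IsAbsCont p := fun _ _ =>
  hp.contDiffOn.absolutelyContinuousOnInterval

theorem IsDensity.integrable {p : ℝ → ℝ} {μ : Measure ℝ} [IsFiniteMeasure μ]
    (hp : IsDensity p μ) : Integrable p := by
  refine ⟨hp.measurable.aestronglyMeasurable,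
    (hasFiniteIntegral_iff_ofReal (Eventually.of_forall hp.nonneg)).2 ?_⟩
  rw [← setLIntegral_univ, ← withDensity_apply _ MeasurableSet.univ, ← hp.eq_withDensity]
  exact measure_lt_top _ _

theorem abs_le_sq_div_add {a b : ℝ} (hb : 0 < b) : |a| ≤ a ^ 2 / b + b := by
  rw [← sub_le_iff_le_add, le_div_iff₀ hb, ← sq_abs]
  nlinarith [sq_nonneg (|a| - b), abs_nonneg a]

theorem IsDensity.integrable_deriv {p : ℝ → ℝ} {μ : Measure ℝ} [IsFiniteMeasure μ]
    (hp : IsDensity p μ) (hI : fisherIntegral p < ∞) : Integrable (deriv p) := by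
  refine ⟨(measurable_deriv p).aestronglyMeasurable, ?_⟩
  have enorm_deriv_le (x : ℝ) : ‖deriv p x‖ₑ ≤
      {x | 0 < p x}.indicator (fun x => ENNReal.ofReal (deriv p x ^ 2 / p x)) x +
        ENNReal.ofReal (p x) := by
    rcases (hp.nonneg x).eq_or_lt with h0 | hpos
    · have hmin : IsLocalMin p x := Eventually.of_forall fun y => h0 ▸ hp.nonneg y
      simp [hmin.deriv_eq_zero]
    · rw [Set.indicator_of_mem (by exact hpos), ← ENNReal.ofReal_add (by positivity) hpos.le,
        Real.enorm_eq_ofReal_abs]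
      exact ENNReal.ofReal_le_ofReal (abs_le_sq_div_add hpos)
  refine (lintegral_mono enorm_deriv_le).trans_lt ?_
  rw [lintegral_add_right _ hp.measurable.ennreal_ofReal,
    lintegral_indicator (measurableSet_lt measurable_const hp.measurable)]
  exact ENNReal.add_lt_top.2 ⟨hI, hp.integrable.lintegral_lt_top⟩

theorem intervalIntegral_translate_sub_le {v : ℝ → ℝ} (hv : Monotone v) {V : ℝ}
    (hV : ∀ x y, v y - v x ≤ V) (a b : ℝ) {h : ℝ} (hh : 0 ≤ h) :
    ∫ x in a..b, (v (x + h) - v x) ≤ V * h := by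
  have hv_int (c d : ℝ) : IntervalIntegrable v volume c d := hv.intervalIntegrable
  have hv_translate (c : ℝ) : Monotone fun x => v (x + c) := fun x y hxy => hv (by linarith)
  calc ∫ x in a..b, (v (x + h) - v x)
      = ∫ x in a..a + h, (v (x + (b - a)) - v x) := by
        rw [intervalIntegral.integral_sub (hv_translate _).intervalIntegrable (hv_int _ _),
          intervalIntegral.integral_sub (hv_translate _).intervalIntegrable (hv_int _ _),
          intervalIntegral.integral_comp_add_right v, intervalIntegral.integral_comp_add_right v,
          intervalIntegral.integral_interval_sub_interval_comm' (hv_int _ _) (hv_int _ _)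
            (hv_int _ _)]
        ring_nf
    _ ≤ ∫ _ in a..a + h, V :=
        intervalIntegral.integral_mono (by linarith)
          ((hv_translate _).intervalIntegrable.sub (hv_int _ _)) intervalIntegrable_const
          fun _ => hV _ _
    _ = V * h := by
        rw [intervalIntegral.integral_const, smul_eq_mul]
        ring

theorem integral_abs_translate_sub_le {f : ℝ → ℝ} (hf : BoundedVariationOn f Set.univ)
    (hi : Integrable f) (h : ℝ) :
    ∫ x, |f (x + h) - f x| ≤ (eVariationOn f Set.univ).toReal * |h| := by
  wlog hh : 0 ≤ h generalizing h
  · rw [← abs_neg, ← integral_add_right_eq_self _ (-h)]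
    simpa [abs_sub_comm] using this (-h) (by linarith)
  have hf_loc := hf.locallyBoundedVariationOn
  set v := variationOnFromTo f Set.univ 0
  have hv : Monotone v := monotoneOn_univ.1 (variationOnFromTo.monotoneOn hf_loc (Set.mem_univ _))
  have v_sub_le (x y : ℝ) : v y - v x ≤ (eVariationOn f Set.univ).toReal := by
    have hadd : v x + variationOnFromTo f Set.univ x y = v y :=
      variationOnFromTo.add hf_loc (Set.mem_univ _) (Set.mem_univ _) (Set.mem_univ _)
    rw [← hadd, add_sub_cancel_left]
    exact (le_abs_self _).trans (variationOnFromTo.abs_le_eVariationOn hf)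
  have hint : Integrable fun x => |f (x + h) - f x| := ((hi.comp_add_right h).sub hi).abs
  refine le_of_tendsto (intervalIntegral_tendsto_integral hint tendsto_neg_atTop_atBot tendsto_id)
    ?_
  filter_upwards [eventually_ge_atTop 0] with R hR
  calc ∫ x in -R..R, |f (x + h) - f x|
      ≤ ∫ x in -R..R, (v (x + h) - v x) := by
        refine intervalIntegral.integral_mono_on (by linarith) hint.intervalIntegrable
          (IntervalIntegrable.sub (Monotone.intervalIntegrable fun x y hxy => hv (by linarith))
            hv.intervalIntegrable) fun x _ => ?_
        exact variationOnFromTo.abs_sub_le_sub_of_le hf_loc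
          (Set.mem_univ _) (Set.mem_univ _) (Set.mem_univ _) (by linarith)
    _ ≤ (eVariationOn f Set.univ).toReal * |h| := by
        rw [abs_of_nonneg hh]
        exact intervalIntegral_translate_sub_le hv v_sub_le _ _ hh

theorem norm_fourier_ofReal_le {f : ℝ → ℝ} (hf : BoundedVariationOn f Set.univ)
    (hi : Integrable f) {w : ℝ} (hw : w ≠ 0) :
    ‖𝓕 (fun x => (f x : ℂ)) w‖ ≤ (eVariationOn f Set.univ).toReal / (4 * |w|) := by
  set h := (1 / (2 * ‖w‖ ^ 2)) • w with hh
  have abs_h : |h| = 1 / (2 * |w|) := by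
    have : |w| ≠ 0 := abs_ne_zero.2 hw
    rw [hh, smul_eq_mul, abs_mul, Real.norm_eq_abs, abs_of_nonneg (by positivity)]
    field_simp
  calc ‖𝓕 (fun x => (f x : ℂ)) w‖
      = 1 / 2 * ‖∫ x, 𝐞 (-inner ℝ x w) • ((f x : ℂ) - f (x + h))‖ := by
        rw [Real.fourier_eq, fourierIntegral_eq_half_sub_half_period_translate hw hi.ofReal,
          norm_smul, norm_div, norm_one, Complex.norm_ofNat]
    _ ≤ 1 / 2 * ∫ x, |f (x + h) - f x| := by
        gcongr
        refine (norm_integral_le_integral_norm _).trans_eq <|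
          integral_congr_ae (.of_forall fun x => ?_)
        simp only [Circle.norm_smul, ← Complex.ofReal_sub, Complex.norm_real, Real.norm_eq_abs,
          abs_sub_comm]
    _ ≤ 1 / 2 * ((eVariationOn f Set.univ).toReal * |h|) := by
        gcongr
        exact integral_abs_translate_sub_le hf hi h
    _ = (eVariationOn f Set.univ).toReal / (4 * |w|) := by
        rw [abs_h]
        ring

theorem IsDensity.charFun_eq {p : ℝ → ℝ} {μ : Measure ℝ} (hp : IsDensity p μ) (t : ℝ) :
    charFun μ t = 𝓕⁻ (fun x => (p x : ℂ)) (t / (2 * Real.pi)) := by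
  rw [charFun_apply_real, hp.eq_withDensity, integral_withDensity_eq_integral_toReal_smul
    hp.measurable.ennreal_ofReal (by simp), Real.fourierInv_eq']
  refine integral_congr_ae (Eventually.of_forall fun x => ?_)
  simp only [ENNReal.toReal_ofReal (hp.nonneg x), Complex.real_smul, smul_eq_mul,
    RCLike.inner_apply, conj_trivial]
  rw [mul_comm]
  congr 3
  push_cast
  field_simp

theorem IsDensity.charFun_isBigO {p : ℝ → ℝ} {μ : Measure ℝ} [IsFiniteMeasure μ]
    (hp : IsDensity p μ) (hV : BoundedVariationOn p Set.univ) :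
    charFun μ =O[atTop] fun t => t⁻¹ := by
  refine Asymptotics.IsBigO.of_bound ((eVariationOn p Set.univ).toReal * Real.pi / 2) ?_
  filter_upwards [eventually_gt_atTop 0] with t ht
  have hw : -(t / (2 * Real.pi)) ≠ 0 := by
    have : 0 < t / (2 * Real.pi) := by positivity
    linarith
  rw [hp.charFun_eq, Real.fourierInv_eq_fourier_neg, Real.norm_of_nonneg (by positivity)]
  refine (norm_fourier_ofReal_le hV hp.integrable hw).trans_eq ?_
  rw [abs_neg, abs_of_pos (by positivity)]
  field_simp
  norm_num

theorem rpow_neg_isBigO_one_add_rpow_neg {ε : ℝ} (hε : 0 ≤ ε) :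
    (fun t : ℝ => t ^ (-ε)) =O[atTop] fun t => (1 + t) ^ (-ε) := by
  refine Asymptotics.IsBigO.of_bound (2 ^ ε) ?_
  filter_upwards [eventually_ge_atTop 1] with t ht
  rw [Real.norm_of_nonneg (by positivity), Real.norm_of_nonneg (by positivity)]
  calc t ^ (-ε) ≤ ((1 + t) / 2) ^ (-ε) :=
        Real.rpow_le_rpow_of_nonpos (by positivity) (by linarith) (by linarith)
    _ = 2 ^ ε * (1 + t) ^ (-ε) := by
        rw [Real.div_rpow (by positivity) (by norm_num), Real.rpow_neg zero_le_two,
          div_inv_eq_mul, mul_comm]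

section Decay

variable {E : Type*} [NormedAddCommGroup E] {f : ℝ → E}

theorem isBigO_rpow_of_norm_pow_isBigO_inv {n : ℕ} (hn : n ≠ 0)
    (h : (fun t => ‖f t‖ ^ n) =O[atTop] fun t => t⁻¹) :
    (fun t => ‖f t‖) =O[atTop] fun t => t ^ (-(1 / n : ℝ)) := by
  refine Asymptotics.IsBigO.of_pow hn (h.congr' .rfl ?_)
  filter_upwards [eventually_ge_atTop 0] with t ht
  rw [Pi.pow_apply, ← Real.rpow_mul_natCast ht, neg_mul, one_div_mul_cancel (by exact_mod_cast hn),
    Real.rpow_neg_one]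

theorem exists_norm_le_one_add_abs_rpow {B : ℝ} (hB : ∀ t, ‖f t‖ ≤ B)
    (heven : ∀ t, ‖f (-t)‖ = ‖f t‖) {ε : ℝ} (hε : 0 ≤ ε)
    (h : f =O[atTop] fun t => t ^ (-ε)) :
    ∃ C, 0 ≤ C ∧ ∀ t, ‖f t‖ ≤ C * (1 + |t|) ^ (-ε) := by
  obtain ⟨c, hc, hb⟩ := (h.trans (rpow_neg_isBigO_one_add_rpow_neg hε)).exists_nonneg
  obtain ⟨T, hT⟩ := eventually_atTop.1 hb.bound
  have : 0 ≤ B := (norm_nonneg _).trans (hB 0)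
  have le_abs_bound (t : ℝ) : ‖f |t|‖ ≤ max c (B * (1 + |T|) ^ ε) * (1 + |t|) ^ (-ε) := by
    rcases le_total T |t| with hTt | htT
    · refine (hT _ hTt).trans ?_
      rw [Real.norm_of_nonneg (by positivity)]
      gcongr
      exact le_max_left _ _
    · calc ‖f |t|‖ ≤ B * ((1 + |T|) ^ ε * (1 + |T|) ^ (-ε)) := by
            rw [← Real.rpow_add (by positivity), add_neg_cancel, Real.rpow_zero, mul_one]
            exact hB _
        _ = B * (1 + |T|) ^ ε * (1 + |T|) ^ (-ε) := by ring
        _ ≤ max c (B * (1 + |T|) ^ ε) * (1 + |t|) ^ (-ε) := by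
            refine mul_le_mul (le_max_right _ _) (Real.rpow_le_rpow_of_nonpos (by positivity) ?_
              (by linarith)) (by positivity) (by positivity)
            linarith [le_abs_self T]
  refine ⟨max c (B * (1 + |T|) ^ ε), hc.trans (le_max_left _ _), fun t => ?_⟩
  have norm_abs : ‖f |t|‖ = ‖f t‖ := by
    rcases abs_choice t with ht | ht <;> simp only [ht, heven]
  exact norm_abs ▸ le_abs_bound t

theorem exists_norm_charFun_le_one_add_abs_rpow {μ : Measure ℝ} [IsProbabilityMeasure μ] {ε : ℝ}
    (hε : 0 ≤ ε) (h : charFun μ =O[atTop] fun t => t ^ (-ε)) :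
    ∃ C, 0 ≤ C ∧ ∀ t, ‖charFun μ t‖ ≤ C * (1 + |t|) ^ (-ε) :=
  exists_norm_le_one_add_abs_rpow norm_charFun_le_one
    (fun t => by rw [charFun_neg, RCLike.norm_conj]) hε h

theorem integrable_norm_rpow_mul_abs (hf : Continuous f) {C ε : ℝ} (hε : 0 < ε) (hC : 0 ≤ C)
    (h : ∀ t, ‖f t‖ ≤ C * (1 + |t|) ^ (-ε)) :
    Integrable fun t => ‖f t‖ ^ (3 / ε) * |t| := by
  have hI : Integrable fun t : ℝ => C ^ (3 / ε) * (1 + ‖t‖) ^ (-2 : ℝ) :=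
    (integrable_one_add_norm (by simp)).const_mul _
  refine hI.mono' (by fun_prop (disch := positivity)) (Eventually.of_forall fun t => ?_)
  have hpos : 0 < 1 + |t| := by positivity
  rw [Real.norm_of_nonneg (by positivity), Real.norm_eq_abs]
  calc ‖f t‖ ^ (3 / ε) * |t|
      ≤ (C * (1 + |t|) ^ (-ε)) ^ (3 / ε) * (1 + |t|) ^ (1 : ℝ) := by
        rw [Real.rpow_one]
        gcongr
        · exact h t
        · linarith
    _ = C ^ (3 / ε) * ((1 + |t|) ^ (-ε * (3 / ε)) * (1 + |t|) ^ (1 : ℝ)) := by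
        rw [Real.mul_rpow hC (by positivity), ← Real.rpow_mul hpos.le, mul_assoc]
    _ = C ^ (3 / ε) * (1 + |t|) ^ (-2 : ℝ) := by
        rw [← Real.rpow_add hpos, neg_mul, mul_div_cancel₀ _ hε.ne']
        norm_num

theorem integrable_norm_charFun_rpow_mul_abs {μ : Measure ℝ} [IsProbabilityMeasure μ] {ε : ℝ}
    (hε : 0 < ε) (h : charFun μ =O[atTop] fun t => t ^ (-ε)) :
    Integrable fun t => ‖charFun μ t‖ ^ (3 / ε) * |t| := by
  obtain ⟨C, hC, hb⟩ := exists_norm_charFun_le_one_add_abs_rpow hε.le h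
  exact integrable_norm_rpow_mul_abs continuous_charFun hε hC hb

theorem norm_rpow_add_one_mul_le_integral {L : ℝ≥0} (hL : L ≠ 0) (hf : LipschitzWith L f) {ν : ℝ}
    (hν : 0 ≤ ν) (h : Integrable fun t => ‖f t‖ ^ ν * |t|) {t : ℝ} (ht : 0 ≤ t) :
    ‖f t‖ ^ (ν + 1) * t ≤ 2 ^ (ν + 1) * L * ∫ s, ‖f s‖ ^ ν * |s| := by
  -- On the interval `[t, t + δ / (2 * L)]` the function `‖f ·‖` stays above `δ / 2`.
  set δ := ‖f t‖
  have : (0 : ℝ) < L := by positivity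
  have hδ : 0 ≤ δ := norm_nonneg _
  have lower_bound : ∀ s ∈ Set.Icc t (t + δ / (2 * L)), (δ / 2) ^ ν * t ≤ ‖f s‖ ^ ν * |s| := by
    intro s ⟨hts, hst⟩
    have hdist : ‖f t - f s‖ ≤ δ / 2 := by
      rw [norm_sub_rev]
      calc ‖f s - f t‖ ≤ L * |s - t| := hf.norm_sub_le s t
        _ ≤ L * (δ / (2 * L)) := by
            rw [abs_of_nonneg (by linarith)]
            gcongr
            linarith
        _ = δ / 2 := by field_simp
    have hhalf : δ / 2 ≤ ‖f s‖ := by linarith [norm_sub_norm_le (f t) (f s)]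
    have : t ≤ |s| := hts.trans (le_abs_self s)
    gcongr
  have hint : (δ / (2 * L)) * ((δ / 2) ^ ν * t) ≤ ∫ s, ‖f s‖ ^ ν * |s| := by
    have hlen : 0 ≤ δ / (2 * L) := by positivity
    calc (δ / (2 * L)) * ((δ / 2) ^ ν * t)
        = ∫ _ in Set.Icc t (t + δ / (2 * L)), (δ / 2) ^ ν * t := by
          rw [setIntegral_const, smul_eq_mul, Real.volume_real_Icc_of_le (by linarith),
            add_sub_cancel_left]
      _ ≤ ∫ s in Set.Icc t (t + δ / (2 * L)), ‖f s‖ ^ ν * |s| :=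
          setIntegral_mono_on continuous_const.integrableOn_Icc h.integrableOn measurableSet_Icc
            lower_bound
      _ ≤ ∫ s, ‖f s‖ ^ ν * |s| :=
          setIntegral_le_integral h (Eventually.of_forall fun _ => by positivity)
  calc δ ^ (ν + 1) * t = 2 ^ (ν + 1) * L * ((δ / (2 * L)) * ((δ / 2) ^ ν * t)) := by
        rw [Real.div_rpow hδ (by norm_num), Real.rpow_add_one' hδ (by positivity),
          Real.rpow_add_one (by norm_num)]
        field_simp
    _ ≤ _ := by gcongr

theorem isBigO_rpow_of_integrable_norm_rpow_mul_abs {L : ℝ≥0} (hf : LipschitzWith L f) {ν : ℝ}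
    (hν : 0 ≤ ν) (h : Integrable fun t => ‖f t‖ ^ ν * |t|) :
    (fun t => ‖f t‖) =O[atTop] fun t => t ^ (-(1 / (ν + 1))) := by
  set K : ℝ≥0 := L + 1
  have hK : LipschitzWith K f := hf.weaken le_self_add
  set J := ∫ s, ‖f s‖ ^ ν * |s|
  have : 0 ≤ J := integral_nonneg fun _ => by positivity
  refine Asymptotics.IsBigO.of_bound ((2 ^ (ν + 1) * K * J) ^ (1 / (ν + 1))) ?_
  filter_upwards [eventually_gt_atTop 0] with t ht
  rw [norm_norm, Real.norm_of_nonneg (by positivity)]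
  calc ‖f t‖ = (‖f t‖ ^ (ν + 1)) ^ (1 / (ν + 1)) := by
        rw [← Real.rpow_mul (norm_nonneg _), mul_one_div_cancel (by positivity), Real.rpow_one]
    _ ≤ (2 ^ (ν + 1) * K * J * t⁻¹) ^ (1 / (ν + 1)) := by
        gcongr
        rw [← div_eq_mul_inv, le_div_iff₀ ht]
        exact norm_rpow_add_one_mul_le_integral (by positivity) hK hν h ht.le
    _ = (2 ^ (ν + 1) * K * J) ^ (1 / (ν + 1)) * t ^ (-(1 / (ν + 1))) := by
        rw [Real.mul_rpow (by positivity) (by positivity), Real.inv_rpow ht.le,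
          ← Real.rpow_neg ht.le]

end Decay

theorem norm_iteratedDeriv_charFun_le {μ : Measure ℝ} [IsFiniteMeasure μ] {n : ℕ}
    (h : MemLp id n μ) (t : ℝ) : ‖iteratedDeriv n (charFun μ) t‖ ≤ ∫ x, |x| ^ n ∂μ := by
  rw [iteratedDeriv_charFun h, norm_mul, norm_pow, Complex.norm_I, one_pow, one_mul]
  refine (norm_integral_le_integral_norm _).trans_eq (integral_congr_ae (.of_forall fun x => ?_))
  simp only [norm_mul, norm_pow, Complex.norm_real, Real.norm_eq_abs, ← Complex.ofReal_mul,
    Complex.norm_exp_ofReal_mul_I, mul_one]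

theorem exists_lipschitzWith_charFun {μ : Measure ℝ} [IsFiniteMeasure μ] (h : MemLp id 1 μ) :
    ∃ L : ℝ≥0, LipschitzWith L (charFun μ) := by
  have h' : MemLp id (1 : ℕ) μ := by simpa only [Nat.cast_one] using h
  refine ⟨Real.toNNReal (∫ x, |x| ^ 1 ∂μ), lipschitzWith_of_nnnorm_deriv_le
    ((contDiff_charFun h').differentiable (by simp)) fun t => ?_⟩
  rw [← iteratedDeriv_one]
  exact NNReal.le_toNNReal_of_coe_le (norm_iteratedDeriv_charFun_le h' t)

theorem exists_norm_iteratedFDeriv_charFun_le_pow {μ : Measure ℝ} [IsProbabilityMeasure μ] {n : ℕ}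
    (h : MemLp id n μ) :
    ∃ M, 0 ≤ M ∧ ∀ k ≤ n, ∀ t, ‖iteratedFDeriv ℝ k (charFun μ) t‖ ≤ M ^ k := by
  have moment_nonneg (k : ℕ) : 0 ≤ ∫ x, |x| ^ k ∂μ := integral_nonneg fun _ => by positivity
  have sum_nonneg : 0 ≤ ∑ k ∈ Finset.range (n + 1), ∫ x, |x| ^ k ∂μ :=
    Finset.sum_nonneg fun k _ => moment_nonneg k
  refine ⟨1 + ∑ k ∈ Finset.range (n + 1), ∫ x, |x| ^ k ∂μ, by positivity, fun k hk t => ?_⟩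
  rcases eq_or_ne k 0 with rfl | hk0
  · simpa only [norm_iteratedFDeriv_zero, pow_zero] using norm_charFun_le_one t
  rw [norm_iteratedFDeriv_eq_norm_iteratedDeriv]
  calc ‖iteratedDeriv k (charFun μ) t‖ ≤ ∫ x, |x| ^ k ∂μ :=
        norm_iteratedDeriv_charFun_le (h.mono_exponent (by exact_mod_cast hk)) t
    _ ≤ 1 + ∑ k ∈ Finset.range (n + 1), ∫ x, |x| ^ k ∂μ := by
        have := Finset.single_le_sum (fun k _ => moment_nonneg k)
          (Finset.mem_range_succ_iff.2 hk)
        linarith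
    _ ≤ _ := le_self_pow₀ (by linarith) hk0

section IteratedDerivPow

variable {𝕜 E A : Type*} [NontriviallyNormedField 𝕜] [NormedAddCommGroup E] [NormedSpace 𝕜 E]
  [NormedRing A] [NormedAlgebra 𝕜 A] {f : E → A} {M : ℝ} {x : E}

theorem pow_mul_norm_iteratedFDeriv_le (hM : 0 ≤ M) {k i : ℕ}
    (h : ∀ j ≤ k, ‖iteratedFDeriv 𝕜 j f x‖ ≤ M ^ j) (hi : i ≤ k) (N : ℕ) :
    ‖f x‖ ^ (N - i) * ‖iteratedFDeriv 𝕜 (k - i) f x‖ ≤ M ^ (k - i) * ‖f x‖ ^ (N + 1 - k) := by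
  have norm_le_one : ‖f x‖ ≤ 1 := by simpa using h 0 k.zero_le
  rcases hi.eq_or_lt with rfl | hik
  -- For `N < i` the subtraction `N - i` truncates; `‖f x‖ ≤ 1` then absorbs the loss.
  · rw [Nat.sub_self, norm_iteratedFDeriv_zero, ← pow_succ, pow_zero, one_mul]
    exact pow_le_pow_of_le_one (norm_nonneg _) norm_le_one (by lia)
  · rw [mul_comm]
    gcongr ?_ * ?_
    · exact h _ (by lia)
    · exact pow_le_pow_of_le_one (norm_nonneg _) norm_le_one (by lia)

theorem norm_iteratedFDeriv_pow_le [NormOneClass A] {n : ℕ} (hf : ContDiff 𝕜 n f) (hM : 0 ≤ M)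
    (h : ∀ i ≤ n, ‖iteratedFDeriv 𝕜 i f x‖ ≤ M ^ i) (N : ℕ) {k : ℕ} (hk : k ≤ n) :
    ‖iteratedFDeriv 𝕜 k (fun y => f y ^ N) x‖ ≤ (N * M) ^ k * ‖f x‖ ^ (N - k) := by
  induction N generalizing k with
  | zero =>
    rcases eq_or_ne k 0 with rfl | hk0
    · simp
    · simp [iteratedFDeriv_const_of_ne hk0]
  | succ N ih =>
    simp only [pow_succ]
    calc ‖iteratedFDeriv 𝕜 k (fun y => f y ^ N * f y) x‖
        ≤ ∑ i ∈ Finset.range (k + 1), (k.choose i : ℝ) *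
            ‖iteratedFDeriv 𝕜 i (fun y => f y ^ N) x‖ * ‖iteratedFDeriv 𝕜 (k - i) f x‖ :=
          norm_iteratedFDeriv_mul_le (hf.pow N) hf x (by exact_mod_cast hk)
      _ ≤ ∑ i ∈ Finset.range (k + 1),
            (N * M) ^ i * M ^ (k - i) * (k.choose i) * ‖f x‖ ^ (N + 1 - k) := by
          refine Finset.sum_le_sum fun i hi => ?_
          have hik : i ≤ k := Finset.mem_range_succ_iff.1 hi
          calc (k.choose i : ℝ) * ‖iteratedFDeriv 𝕜 i (fun y => f y ^ N) x‖ *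
                ‖iteratedFDeriv 𝕜 (k - i) f x‖
              ≤ k.choose i * ((N * M) ^ i * ‖f x‖ ^ (N - i)) *
                ‖iteratedFDeriv 𝕜 (k - i) f x‖ := by
                gcongr
                exact ih (hik.trans hk)
            _ = k.choose i * (N * M) ^ i *
                (‖f x‖ ^ (N - i) * ‖iteratedFDeriv 𝕜 (k - i) f x‖) := by ring
            _ ≤ k.choose i * (N * M) ^ i * (M ^ (k - i) * ‖f x‖ ^ (N + 1 - k)) := by
                gcongr ?_ * ?_
                exact pow_mul_norm_iteratedFDeriv_le hM (fun j hj => h j (hj.trans hk)) hik N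
            _ = _ := by ring
      _ = ((N + 1 : ℕ) * M) ^ k * ‖f x‖ ^ (N + 1 - k) := by
          rw [← Finset.sum_mul, ← add_pow, Nat.cast_succ, add_one_mul]

end IteratedDerivPow

theorem integrable_norm_pow_mul_iteratedFDeriv_pow {n : ℕ} {f : ℝ → ℂ} (hf : ContDiff ℝ n f)
    {M : ℝ} (hM : 0 ≤ M) (h : ∀ i ≤ n, ∀ x, ‖iteratedFDeriv ℝ i f x‖ ≤ M ^ i) {C ε : ℝ}
    (hC : ∀ x, ‖f x‖ ≤ C * (1 + |x|) ^ (-ε)) {j k N : ℕ} (hk : k ≤ n)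
    (hN : j + 1 < ε * (N - k : ℕ)) :
    Integrable fun x => ‖x‖ ^ j * ‖iteratedFDeriv ℝ k (fun y => f y ^ N) x‖ := by
  have hI : Integrable fun x : ℝ =>
      (N * M) ^ k * C ^ (N - k) * (1 + ‖x‖) ^ (-(ε * (N - k : ℕ) - j)) :=
    (integrable_one_add_norm (by simpa using by linarith)).const_mul _
  have hcont : Continuous (iteratedFDeriv ℝ k fun y => f y ^ N) :=
    (hf.pow N).continuous_iteratedFDeriv (by exact_mod_cast hk)
  refine hI.mono' (by fun_prop) (Eventually.of_forall fun x => ?_)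
  have hpos : 0 < 1 + ‖x‖ := by positivity
  rw [Real.norm_of_nonneg (by positivity)]
  calc ‖x‖ ^ j * ‖iteratedFDeriv ℝ k (fun y => f y ^ N) x‖
      ≤ (1 + ‖x‖) ^ j * ((N * M) ^ k * (C * (1 + ‖x‖) ^ (-ε)) ^ (N - k)) := by
        gcongr
        · linarith
        · refine (norm_iteratedFDeriv_pow_le hf hM (fun i hi => h i hi x) N hk).trans ?_
          gcongr
          exact hC x
    _ = (N * M) ^ k * C ^ (N - k) *
        ((1 + ‖x‖) ^ (-ε * (N - k : ℕ)) * (1 + ‖x‖) ^ (j : ℝ)) := by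
        rw [mul_pow C, Real.rpow_mul_natCast hpos.le, Real.rpow_natCast]
        ring
    _ = (N * M) ^ k * C ^ (N - k) * (1 + ‖x‖) ^ (-(ε * (N - k : ℕ) - j)) := by
        rw [← Real.rpow_add hpos]
        ring_nf

theorem exists_norm_iteratedFDeriv_fourier_le {E : Type*} [NormedAddCommGroup E] [NormedSpace ℂ E]
    {f : ℝ → E} (hf : ContDiff ℝ 2 f) {K : ℕ}
    (h : ∀ j k : ℕ, j ≤ K → k ≤ 2 → Integrable fun x => ‖x‖ ^ j * ‖iteratedFDeriv ℝ k f x‖)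
    {j : ℕ} (hj : j ≤ K) :
    ∃ D, ∀ x, ‖iteratedFDeriv ℝ j (𝓕 f) x‖ ≤ D / (1 + x ^ 2) := by
  have pow_mul_le (n : ℕ) (hn : n ≤ 2) : ∃ B, ∀ x, |x| ^ n * ‖iteratedFDeriv ℝ j (𝓕 f) x‖ ≤ B :=
    ⟨_, Real.pow_mul_norm_iteratedFDeriv_fourier_le (K := K) (N := 2) hf
      (fun j k hj hk => h j k (by exact_mod_cast hj) (by exact_mod_cast hk))
      (by exact_mod_cast hj) (by exact_mod_cast hn)⟩
  obtain ⟨B₀, hB₀⟩ := pow_mul_le 0 zero_le_two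
  obtain ⟨B₂, hB₂⟩ := pow_mul_le 2 le_rfl
  refine ⟨B₀ + B₂, fun x => ?_⟩
  rw [le_div_iff₀ (by positivity), mul_comm, one_add_mul]
  simpa only [pow_zero, one_mul, sq_abs] using add_le_add (hB₀ x) (hB₂ x)

theorem charFun_withDensity_ofReal_sub {f : ℝ → ℝ} (hf : Measurable f) (hi : Integrable f)
    (t : ℝ) :
    charFun (volume.withDensity fun x => ENNReal.ofReal (f x)) t -
      charFun (volume.withDensity fun x => ENNReal.ofReal (-f x)) t =
      𝓕⁻ (fun x => (f x : ℂ)) (t / (2 * Real.pi)) := by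
  have isDensity_posPart {g : ℝ → ℝ} (hg : Measurable g) : IsDensity (fun x => max (g x) 0)
      (volume.withDensity fun x => ENNReal.ofReal (g x)) :=
    ⟨hg.max measurable_const, fun x => le_max_right _ _, by simp⟩
  rw [(isDensity_posPart hf).charFun_eq, (isDensity_posPart (g := fun x => -f x) hf.neg).charFun_eq]
  simp only [Real.fourierInv_eq_fourier_neg, Real.fourier_eq]
  rw [← integral_sub]
  · simp only [← smul_sub, ← Complex.ofReal_sub, max_zero_sub_max_neg_zero_eq_self]
  · exact (Real.fourierIntegral_convergent_iff _).2 hi.pos_part.ofReal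
  · exact (Real.fourierIntegral_convergent_iff _).2 hi.neg.pos_part.ofReal

theorem IsDensity.of_add_withDensity_eq {f : ℝ → ℝ} (hf : Continuous f) {μ : Measure ℝ}
    (h : μ + volume.withDensity (fun x => ENNReal.ofReal (-f x)) =
      volume.withDensity fun x => ENNReal.ofReal (f x)) : IsDensity f μ := by
  have hopen : IsOpen {x | f x < 0} := isOpen_lt hf continuous_const
  have null_of_neg : volume {x | f x < 0} = 0 := by
    have pos_null : volume.withDensity (fun x => ENNReal.ofReal (f x)) {x | f x < 0} = 0 := by
      rw [withDensity_apply_eq_zero (by fun_prop)]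
      refine measure_mono_null (fun x hx => ?_) measure_empty
      exact hx.1 (ENNReal.ofReal_of_nonpos (le_of_lt hx.2))
    rw [← h, Measure.add_apply, add_eq_zero, withDensity_apply_eq_zero (by fun_prop)] at pos_null
    refine measure_mono_null ?_ pos_null.2
    exact fun x hx => ⟨by simpa using hx, hx⟩
  have nonneg (x : ℝ) : 0 ≤ f x := by
    by_contra! hx
    exact (hopen.measure_pos volume ⟨x, hx⟩).ne' null_of_neg
  refine ⟨hf.measurable, nonneg, ?_⟩
  simpa [ENNReal.ofReal_of_nonpos (neg_nonpos.2 (nonneg _))] using h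

theorem IsDensity.of_charFun_eq {f : ℝ → ℝ} (hf : Continuous f) (hi : Integrable f)
    {μ : Measure ℝ} [IsFiniteMeasure μ]
    (h : ∀ t, charFun μ t = 𝓕⁻ (fun x => (f x : ℂ)) (t / (2 * Real.pi))) : IsDensity f μ := by
  have := isFiniteMeasure_withDensity_ofReal hi.2
  have := isFiniteMeasure_withDensity_ofReal hi.neg.2
  refine .of_add_withDensity_eq hf (Measure.ext_of_charFun (funext fun t => ?_))
  have charFun_add (κ : Measure ℝ) [IsFiniteMeasure κ] :
      charFun (μ + κ) t = charFun μ t + charFun κ t := by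
    simp only [charFun_eq_integral_innerProbChar]
    exact integral_add_measure (BoundedContinuousFunction.integrable _ _)
      (BoundedContinuousFunction.integrable _ _)
  rw [charFun_add, h, ← charFun_withDensity_ofReal_sub hf.measurable hi, sub_add_cancel]

theorem conj_fourier_of_conj_eq_comp_neg {f : ℝ → ℂ} (hf : ∀ x, conj (f x) = f (-x)) (w : ℝ) :
    conj (𝓕 f w) = 𝓕 f w := by
  calc conj (𝓕 f w) = 𝓕⁻ (fun x => conj (f x)) w := by
        simp only [Real.fourier_eq, Real.fourierInv_eq, ← integral_conj, Circle.smul_def,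
          smul_eq_mul, map_mul, AddChar.map_neg_eq_inv, ← Circle.coe_inv_eq_conj, inv_inv]
    _ = 𝓕 f w := by simp only [hf, Real.fourierInv_eq_fourier_comp_neg, neg_neg]

theorem isDensity_re_fourier {μ : Measure ℝ} [IsFiniteMeasure μ] {f : ℝ → ℂ} (hf : Continuous f)
    (hi : Integrable f) (hc : Continuous (𝓕 f)) (hi' : Integrable (𝓕 f))
    (h : ∀ x, charFun μ (2 * Real.pi * x) = f x) : IsDensity (fun x => (𝓕 f x).re) μ := by
  have ofReal_re : (fun x => ((𝓕 f x).re : ℂ)) = 𝓕 f := funext fun x =>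
    Complex.conj_eq_iff_re.1 <| conj_fourier_of_conj_eq_comp_neg
      (fun x => by rw [← h, ← h, mul_neg, charFun_neg]) x
  refine .of_charFun_eq (Complex.continuous_re.comp hc) hi'.re fun t => ?_
  change charFun μ t = 𝓕⁻ (fun x => ((𝓕 f x).re : ℂ)) _
  rw [ofReal_re, hf.fourierInv_fourier_eq hi hi', ← h, mul_div_cancel₀ _ (by positivity)]

theorem integrable_of_norm_le_div_one_add_sq {E : Type*} [NormedAddCommGroup E] {f : ℝ → E}
    (hf : AEStronglyMeasurable f) {D : ℝ} (h : ∀ x, ‖f x‖ ≤ D / (1 + x ^ 2)) : Integrable f :=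
  (integrable_inv_one_add_sq.const_mul D).mono' hf (Eventually.of_forall h)

theorem abs_iteratedDeriv_re_le {f : ℝ → ℂ} {n : ℕ} (hf : ContDiff ℝ n f) (x : ℝ) :
    |iteratedDeriv n (fun y => (f y).re) x| ≤ ‖iteratedFDeriv ℝ n f x‖ := by
  rw [← Real.norm_eq_abs, ← norm_iteratedFDeriv_eq_norm_iteratedDeriv]
  change ‖iteratedFDeriv ℝ n (Complex.reCLM ∘ f) x‖ ≤ _
  rw [Complex.reCLM.iteratedFDeriv_comp_left hf.contDiffAt le_rfl]
  simpa using Complex.reCLM.norm_compContinuousMultilinearMap_le (iteratedFDeriv ℝ n f x)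

theorem exists_contDiff_density_of_charFun_eq_pow {μ ν : Measure ℝ} [IsProbabilityMeasure μ]
    [IsFiniteMeasure ν] (hμ : MemLp id 2 μ) {C ε : ℝ}
    (hC : ∀ t, ‖charFun μ t‖ ≤ C * (1 + |t|) ^ (-ε)) {K N : ℕ} (hN : K + 1 < ε * (N - 2 : ℕ))
    (hν : ∀ t, charFun ν (2 * Real.pi * t) = charFun μ t ^ N) :
    ∃ p, IsDensity p ν ∧ ContDiff ℝ K p ∧
      ∃ D : ℕ → ℝ, ∀ k ≤ K, ∀ x, |iteratedDeriv k p x| ≤ D k / (1 + x ^ 2) := by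
  have hμ' : MemLp id (2 : ℕ) μ := by simpa using hμ
  have hε : 0 < ε :=
    pos_of_mul_pos_left ((by positivity : (0 : ℝ) < K + 1).trans hN) (by positivity)
  obtain ⟨M, hM, hbound⟩ := exists_norm_iteratedFDeriv_charFun_le_pow hμ'
  have hcont : ContDiff ℝ 2 fun t => charFun μ t ^ N := (contDiff_charFun hμ').pow N
  have hint (j k : ℕ) (hj : j ≤ K) (hk : k ≤ 2) :
      Integrable fun x => ‖x‖ ^ j * ‖iteratedFDeriv ℝ k (fun t => charFun μ t ^ N) x‖ := by
    refine integrable_norm_pow_mul_iteratedFDeriv_pow (contDiff_charFun hμ') hM hbound hC hk ?_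
    calc (j + 1 : ℝ) ≤ K + 1 := by gcongr
      _ < ε * (N - 2 : ℕ) := hN
      _ ≤ ε * (N - k : ℕ) := by gcongr
  have hsmooth : ContDiff ℝ K (𝓕 fun t => charFun μ t ^ N) :=
    Real.contDiff_fourier (N := K) fun j hj => by
      simpa using hint j 0 (by exact_mod_cast hj) (by norm_num)
  choose! D hD using fun k (hk : k ≤ K) => exists_norm_iteratedFDeriv_fourier_le hcont hint hk
  have hint₀ : Integrable fun t => charFun μ t ^ N :=
    (integrable_norm_iff hcont.continuous.aestronglyMeasurable).1 <| by
      simpa using hint 0 0 K.zero_le zero_le_two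
  have hint_fourier : Integrable (𝓕 fun t => charFun μ t ^ N) :=
    integrable_of_norm_le_div_one_add_sq hsmooth.continuous.aestronglyMeasurable
      fun x => by simpa using hD 0 K.zero_le x
  refine ⟨fun x => (𝓕 (fun t => charFun μ t ^ N) x).re,
    isDensity_re_fourier hcont.continuous hint₀ hsmooth.continuous hint_fourier hν,
    Complex.reCLM.contDiff.comp hsmooth, D, fun k hk x => ?_⟩
  exact (abs_iteratedDeriv_re_le (hsmooth.of_le (Nat.cast_le.2 hk)) x).trans (hD k hk x)

theorem exists_contDiff_density_of_charFun_isBigO {μ ν : Measure ℝ} [IsProbabilityMeasure μ]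
    [IsFiniteMeasure ν] (hμ : MemLp id 2 μ) {ε : ℝ}
    (h : charFun μ =O[atTop] fun t => t ^ (-ε)) {K N : ℕ} (hN : K + 1 < ε * (N - 2 : ℕ)) {c : ℝ}
    (hc : 0 < c) (hν : ∀ t, charFun ν t = charFun μ (c * t) ^ N) :
    ∃ p, IsDensity p ν ∧ ContDiff ℝ K p ∧
      ∃ D : ℕ → ℝ, ∀ k ≤ K, ∀ x, |iteratedDeriv k p x| ≤ D k / (1 + x ^ 2) := by
  have hε : 0 < ε :=
    pos_of_mul_pos_left ((by positivity : (0 : ℝ) < K + 1).trans hN) (by positivity)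
  have hb : 0 < c * (2 * Real.pi) := by positivity
  set b := c * (2 * Real.pi) with hb_def
  have hprob : IsProbabilityMeasure (μ.map (b * ·)) :=
    Measure.isProbabilityMeasure_map (by fun_prop)
  have hdecay : charFun (μ.map (b * ·)) =O[atTop] fun t => t ^ (-ε) := by
    refine .trans (g := fun t => (b * t) ^ (-ε)) ?_ ?_
    · rw [funext (charFun_map_mul b)]
      exact h.comp_tendsto (tendsto_id.const_mul_atTop hb)
    · refine .of_bound (b ^ (-ε)) ?_
      filter_upwards [eventually_ge_atTop 0] with t ht
      rw [Real.mul_rpow hb.le ht, norm_mul, Real.norm_of_nonneg (by positivity)]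
  obtain ⟨C, -, hC⟩ := exists_norm_charFun_le_one_add_abs_rpow hε.le hdecay
  refine exists_contDiff_density_of_charFun_eq_pow ?_ hC hN fun t => ?_
  · exact (memLp_map_measure_iff aestronglyMeasurable_id (by fun_prop)).2 (hμ.const_mul b)
  · rw [hν, charFun_map_mul, hb_def, mul_assoc c]

theorem exists_eq_add_deriv_mul_add_iteratedDeriv_two {p : ℝ → ℝ} (hp : ContDiff ℝ 2 p)
    (x s : ℝ) : ∃ y, |y - x| ≤ |s| ∧
      p (x + s) = p x + deriv p x * s + iteratedDeriv 2 p y * s ^ 2 / 2 := by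
  rcases eq_or_ne s 0 with rfl | hs
  · exact ⟨x, by simp⟩
  have hx : x ≠ x + s := by simpa using hs
  obtain ⟨y, hy, htaylor⟩ :=
    taylor_mean_remainder_lagrange_iteratedDeriv (n := 1) hx hp.contDiffOn
  refine ⟨y, by simpa using Set.abs_sub_left_of_mem_uIcc (Set.uIoo_subset_uIcc_self hy), ?_⟩
  rw [taylorWithinEval_succ, taylor_within_zero_eval, iteratedDerivWithin_one,
    (hp.differentiable two_ne_zero x).derivWithin (uniqueDiffOn_uIcc hx x Set.left_mem_uIcc),
    add_sub_cancel_left, sub_eq_iff_eq_add'] at htaylor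
  simpa [mul_comm s] using htaylor

theorem sq_deriv_le_of_nonneg {p : ℝ → ℝ} {x M : ℝ} (hp : ContDiff ℝ 2 p) (h₀ : ∀ y, 0 ≤ p y)
    (h₁ : |deriv p x| ≤ M) (h₂ : ∀ y, |y - x| ≤ 1 → |iteratedDeriv 2 p y| ≤ M) :
    deriv p x ^ 2 ≤ 2 * M * p x := by
  rcases ((abs_nonneg _).trans h₁).eq_or_lt with rfl | hM
  · simp [abs_nonpos_iff.1 h₁]
  -- The step `s` minimizes the quadratic Taylor bound `p x + p' x * s + M * s ^ 2 / 2`.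
  set s := -deriv p x / M with hs
  have hs_le : |s| ≤ 1 := by rwa [hs, abs_div, abs_neg, abs_of_pos hM, div_le_one hM]
  obtain ⟨y, hy, htaylor⟩ := exists_eq_add_deriv_mul_add_iteratedDeriv_two hp x s
  have hbound : 0 ≤ p x - deriv p x ^ 2 / (2 * M) :=
    calc 0 ≤ p (x + s) := h₀ _
      _ = p x + deriv p x * s + iteratedDeriv 2 p y * s ^ 2 / 2 := htaylor
      _ ≤ p x + deriv p x * s + M * s ^ 2 / 2 := by
        gcongr
        exact (le_abs_self _).trans (h₂ y (hy.trans hs_le))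
      _ = p x - deriv p x ^ 2 / (2 * M) := by
        rw [hs]
        field_simp
        ring
  rwa [sub_nonneg, div_le_iff₀' (by positivity)] at hbound

theorem one_add_sq_le_of_abs_sub_le_one {x y : ℝ} (h : |y - x| ≤ 1) :
    1 + x ^ 2 ≤ 3 * (1 + y ^ 2) := by
  have hsq : (y - x) ^ 2 ≤ 1 := (sq_le_one_iff_abs_le_one _).2 h
  nlinarith [sq_nonneg (y + (y - x))]

theorem fisherIntegral_lt_top {p : ℝ → ℝ} (hp : ContDiff ℝ 2 p) (h₀ : ∀ x, 0 ≤ p x) {D₁ D₂ : ℝ}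
    (h₁ : ∀ x, |deriv p x| ≤ D₁ / (1 + x ^ 2))
    (h₂ : ∀ x, |iteratedDeriv 2 p x| ≤ D₂ / (1 + x ^ 2)) : fisherIntegral p < ∞ := by
  set D := max D₁ D₂
  have hD : 0 ≤ D := by
    have := (abs_nonneg _).trans (h₁ 0)
    exact le_max_of_le_left (by simpa using this)
  have hsq (x : ℝ) : deriv p x ^ 2 ≤ 2 * (3 * D / (1 + x ^ 2)) * p x := by
    refine sq_deriv_le_of_nonneg hp h₀ ((h₁ x).trans ?_) fun y hy => (h₂ y).trans ?_
    · gcongr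
      exact (le_max_left D₁ D₂).trans (by linarith)
    · rw [div_le_div_iff₀ (by positivity) (by positivity)]
      calc D₂ * (1 + x ^ 2) ≤ D * (3 * (1 + y ^ 2)) := by
            gcongr
            exacts [le_max_right .., one_add_sq_le_of_abs_sub_le_one hy]
        _ = 3 * D * (1 + y ^ 2) := by ring
  have hint : Integrable fun x : ℝ => 6 * D * (1 + x ^ 2)⁻¹ :=
    integrable_inv_one_add_sq.const_mul _
  refine lt_of_le_of_lt ?_ hint.lintegral_lt_top
  have hpos : MeasurableSet {x | 0 < p x} :=
    (isOpen_lt continuous_const hp.continuous).measurableSet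
  refine (setLIntegral_mono' hpos fun x (hx : 0 < p x) => ENNReal.ofReal_le_ofReal ?_).trans
    (setLIntegral_le_lintegral _ _)
  rw [div_le_iff₀ hx]
  exact (hsq x).trans_eq (by ring)

theorem IsDensity.fisherInfo_lt_top {μ : Measure ℝ} {p : ℝ → ℝ} (hp : IsDensity p μ)
    (hC : ContDiff ℝ 2 p) {D₁ D₂ : ℝ} (h₁ : ∀ x, |deriv p x| ≤ D₁ / (1 + x ^ 2))
    (h₂ : ∀ x, |iteratedDeriv 2 p x| ≤ D₂ / (1 + x ^ 2)) : fisherInfo μ < ∞ :=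
  (iInf_le_of_le p (iInf₂_le hp (.of_contDiff (hC.of_le one_le_two)))).trans_lt
    (fisherIntegral_lt_top hC hp.nonneg h₁ h₂)

section NormalizedSum

variable {Ω : Type*} [MeasurableSpace Ω] {P : Measure Ω} {X : ℕ → Ω → ℝ}

theorem charFun_map_normalizedSum (hindep : iIndepFun X P)
    (hident : ∀ i, IdentDistrib (X i) (X 0) P P) (n : ℕ) (t : ℝ) :
    charFun (P.map (normalizedSum X n)) t = charFun (P.map (X 0)) ((√(n : ℝ))⁻¹ * t) ^ n := by
  rw [← charFun_inv_sqrt_mul_sum hindep hident]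
  congr 2
  funext ω
  rw [normalizedSum, div_eq_inv_mul]

theorem charFun_isBigO_of_boundedVariationOn_density [IsFiniteMeasure P] (hindep : iIndepFun X P)
    (hident : ∀ i, IdentDistrib (X i) (X 0) P P) {n : ℕ} (hn : n ≠ 0) {p : ℝ → ℝ}
    (hp : IsDensity p (P.map (normalizedSum X n))) (hV : BoundedVariationOn p Set.univ) :
    (fun t => ‖charFun (P.map (X 0)) t‖) =O[atTop] fun t => t ^ (-(1 / n : ℝ)) := by
  have hsqrt : 0 < √(n : ℝ) := by positivity
  refine isBigO_rpow_of_norm_pow_isBigO_inv hn ?_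
  have hpow (t : ℝ) : charFun (P.map (X 0)) t ^ n =
      charFun (P.map (normalizedSum X n)) (√n * t) := by
    rw [charFun_map_normalizedSum hindep hident, inv_mul_cancel_left₀ hsqrt.ne']
  simp only [← norm_pow, hpow]
  refine (((hp.charFun_isBigO hV).comp_tendsto
    (tendsto_id.const_mul_atTop hsqrt)).trans ?_).norm_left
  simpa [Function.comp_def, mul_comm] using
    Asymptotics.isBigO_const_mul_self (√(n : ℝ))⁻¹ (fun t : ℝ => t⁻¹) atTop

theorem exists_contDiff_density_normalizedSum [IsProbabilityMeasure P] (hindep : iIndepFun X P)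
    (hident : ∀ i, IdentDistrib (X i) (X 0) P P) (hmom : MemLp (X 0) 2 P) {ε : ℝ} (hε : 0 < ε)
    (h : charFun (P.map (X 0)) =O[atTop] fun t => t ^ (-ε)) (K : ℕ) :
    ∃ n, 1 ≤ n ∧ ∃ p, IsDensity p (P.map (normalizedSum X n)) ∧ ContDiff ℝ K p ∧
      ∃ D : ℕ → ℝ, ∀ k ≤ K, ∀ x, |iteratedDeriv k p x| ≤ D k / (1 + x ^ 2) := by
  obtain ⟨m, hm⟩ := exists_nat_gt ((K + 1) / ε)
  have hX : AEMeasurable (X 0) P := (hident 0).aemeasurable_fst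
  have : IsProbabilityMeasure (P.map (X 0)) := Measure.isProbabilityMeasure_map hX
  refine ⟨m + 2, by lia, exists_contDiff_density_of_charFun_isBigO (N := m + 2) ?_ h ?_ ?_
    (charFun_map_normalizedSum hindep hident (m + 2))⟩
  · exact (memLp_map_measure_iff aestronglyMeasurable_id hX).2 hmom
  · rwa [add_tsub_cancel_right, ← div_lt_iff₀' hε]
  · positivity

end NormalizedSum

theorem theorem1p3 {Ω : Type*} [MeasurableSpace Ω] (P : Measure Ω) [IsProbabilityMeasure P]
    (X : ℕ → Ω → ℝ) (hindep : iIndepFun X P) (hident : ∀ i, IdentDistrib (X i) (X 0) P P)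
    (hmom : MemLp (X 0) 2 P) :
    List.TFAE [
      ∃ n : ℕ, 1 ≤ n ∧ fisherInfo (P.map (normalizedSum X n)) < ∞,
      ∃ n : ℕ, 1 ≤ n ∧ ∃ p : ℝ → ℝ, IsDensity p (P.map (normalizedSum X n)) ∧
        BoundedVariationOn p Set.univ,
      ∃ n : ℕ, 1 ≤ n ∧ ∃ p : ℝ → ℝ, IsDensity p (P.map (normalizedSum X n)) ∧
        ContDiff ℝ 1 p ∧ Integrable (deriv p) volume,
      ∃ ε : ℝ, 0 < ε ∧
        (fun t : ℝ => ‖charFun (P.map (X 0)) t‖) =O[atTop] (fun t : ℝ => t ^ (-ε)),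
      ∃ ν : ℝ, 0 < ν ∧
        Integrable (fun t : ℝ => ‖charFun (P.map (X 0)) t‖ ^ ν * |t|) volume] := by
  have hX : AEMeasurable (X 0) P := (hident 0).aemeasurable_fst
  have : IsProbabilityMeasure (P.map (X 0)) := Measure.isProbabilityMeasure_map hX
  tfae_have 1 → 2 := by
    simp only [fisherInfo, iInf_lt_iff]
    rintro ⟨n, hn, p, hp, hac, hI⟩
    exact ⟨n, hn, p, hp, hac.boundedVariationOn (hp.integrable_deriv hI)⟩
  tfae_have 3 → 2 := fun ⟨n, hn, p, hp, hC, hI⟩ =>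
    ⟨n, hn, p, hp, (IsAbsCont.of_contDiff hC).boundedVariationOn hI⟩
  tfae_have 2 → 4 := fun ⟨n, hn, p, hp, hV⟩ => ⟨1 / n, by positivity,
    charFun_isBigO_of_boundedVariationOn_density hindep hident (by lia) hp hV⟩
  tfae_have 4 → 5 := fun ⟨ε, hε, h⟩ =>
    ⟨3 / ε, by positivity, integrable_norm_charFun_rpow_mul_abs hε h.of_norm_left⟩
  tfae_have 5 → 4 := fun ⟨ν, hν, h⟩ => by
    obtain ⟨L, hL⟩ := exists_lipschitzWith_charFun <|
      (memLp_map_measure_iff aestronglyMeasurable_id hX).2 (hmom.mono_exponent one_le_two)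
    exact ⟨1 / (ν + 1), by positivity, isBigO_rpow_of_integrable_norm_rpow_mul_abs hL hν.le h⟩
  tfae_have 4 → 3 := fun ⟨ε, hε, h⟩ => by
    obtain ⟨n, hn, p, hp, hC, D, hD⟩ :=
      exists_contDiff_density_normalizedSum hindep hident hmom hε h.of_norm_left 1
    exact ⟨n, hn, p, hp, hC, integrable_of_norm_le_div_one_add_sq (D := D 1)
      (measurable_deriv p).aestronglyMeasurable (by simpa using hD 1 le_rfl)⟩
  tfae_have 4 → 1 := fun ⟨ε, hε, h⟩ => by
    obtain ⟨n, hn, p, hp, hC, D, hD⟩ :=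
      exists_contDiff_density_normalizedSum hindep hident hmom hε h.of_norm_left 2
    exact ⟨n, hn, hp.fisherInfo_lt_top hC (by simpa using hD 1 one_le_two) (hD 2 le_rfl)⟩
  tfae_finish
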